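/- **Setting.** Let $Act$ be a set of visible actions, $\tau\notin Act$, $Act_\tau=Act\cup\{\tau\}$, and let $V_{AR}$ be an infinite set of variables. The terms of $\mathrm{CLL}_R$ are $$t::=0\mid\bot\mid\alpha.t\mid t\,\Box\,t\mid t\wedge t\mid t\vee t\mid t\parallel_A t\mid X\mid\langle Z|E\rangle ,$$ where $\alpha\in Act_\tau$, $A\subseteq Act$, $X\in V_{AR}$, and $E=\{X=t_X : X\in V\}$ is a recursive specification with $V\subseteq V_{AR}$ and $Z\in V$; $\langle Z|E\rangle$ binds the variables of $V$ in all the $t_X$. An occurrence of $X$ in $t$ is strongly guarded if it lies within a subterm $a.t_1$ with $a\in Act$, and weakly guarded if it lies within a subterm $\tau.t_1$ or $t_1\vee t_2$. $E$ is guarded (strongly guarded) if every free occurrence of each $X\in V$ in each $t_Y$, $Y\in V$, is strongly or weakly guarded (is strongly guarded). A process is a closed term in which all recursive specifications are guarded. Write $\langle t|E\rangle$ for $t$ with each free $X\in V$ replaced by $\langle X|E\rangle$. **Semantics.** The operational rules of $\mathrm{CLL}_R$ are, for $a\in Act$, $\alpha\in Act_\tau$: * $\alpha.x\xrightarrow{\alpha}x$;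 $\ x_1\vee x_2\xrightarrow{\tau}x_i$ for $i=1,2$; and $\langle X|E\rangle\xrightarrow{\alpha}y$ if $\langle t_X|E\rangle\xrightarrow{\alpha}y$. * For $\odot\in\{\Box,\wedge,\parallel_A\}$: if $x_1\xrightarrow{\tau}y_1$ then $x_1\odot x_2\xrightarrow{\tau}y_1\odot x_2$, and symmetrically. * If $x_1\xrightarrow{a}y_1$ and $x_2\not\xrightarrow{\tau}$ then $x_1\Box x_2\xrightarrow{a}y_1$ and, provided $a\notin A$, $x_1\parallel_A x_2\xrightarrow{a}y_1\parallel_A x_2$; and symmetrically. * If $x_1\xrightarrow{a}y_1$ and $x_2\xrightarrow{a}y_2$ then $x_1\wedge x_2\xrightarrow{a}y_1\wedge y_2$ and, provided $a\in A$, $x_1\parallel_A x_2\xrightarrow{a}y_1\parallel_A y_2$. The rules for the inconsistency predicate $F$ are, where $p\stackrel{\epsilon}{\Rightarrow}|\,q$ means that $q$ is reached from $p$ by finitely many (possibly zero) $\tau$-transitions and $q\not\xrightarrow{\tau}$: * $\bot F$; if $xF$ then $\alpha.x\,F$; if $x_1F$ and $x_2F$ then $x_1\vee x_2\,F$; if $x_1F$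 or $x_2F$ then $x_1\odot x_2\,F$ for $\odot\in\{\Box,\wedge,\parallel_A\}$. * $x_1\wedge x_2\,F$ if $x_1\wedge x_2\not\xrightarrow{\tau}$ and, for some $a\in Act$, exactly one of $x_1,x_2$ has an $a$-transition. * $x_1\wedge x_2\,F$ if, for some $\alpha$, it has an $\alpha$-transition and $yF$ for all $y$ with $x_1\wedge x_2\xrightarrow{\alpha}y$. * $x_1\wedge x_2\,F$ if $yF$ for all $y$ with $x_1\wedge x_2\stackrel{\epsilon}{\Rightarrow}|\,y$. * $\langle X|E\rangle F$ if $\langle t_X|E\rangle F$; and $\langle X|E\rangle F$ if $yF$ for all $y$ with $\langle X|E\rangle\stackrel{\epsilon}{\Rightarrow}|\,y$. $\mathrm{CLL}_R$ has a unique stable transition model $M$, that is, a unique set $M$ of literals $p\xrightarrow{\alpha}q$ and $pF$ over processes which consists exactly of the literals provable from the ground instances of the rules when negative premises, and the index sets of the families of premises $\{yF:\dots\}$, are evaluated in $M$. Let $F$ be the set of all processes $p$ with $pF\in M$. **Extended basic terms.** Let $ET(\Sigma_B)$ be the set of all terms generated by $$t::=0\mid\alpha.t\mid t\,\Box\,t\mid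 t\vee t\mid t\parallel_A t\mid X\mid\langle Z|E\rangle ,$$ where $\alpha\in Act_\tau$, $A\subseteq Act$, $X\in V_{AR}$, and $E=\{Y=t_Y:Y\in V\}$ is strongly guarded with all $t_Y\in ET(\Sigma_B)$. (This includes all $\langle X|X=t\rangle$ with $t\in ET(\Sigma_B)$ and $X$ strongly guarded in $t$.) **Proposition.** $ET(\Sigma_B)\cap F=\emptyset$; that is, no process that is an extended basic term is inconsistent. -/

import Mathlib

namespace CLLR

/-- The actions `Act ∪ {τ}`: visible actions and the invisible action `τ`. -/
inductive Action (Act : Type*) where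
  | vis (a : Act)
  | tau

/-- Raw terms of `CLL_R`, over visible actions `Act` and recursion variables `Var`:
`0`, `⊥`, `α.t`, `t □ t`, `t ∧ t`, `t ∨ t`, `t ∥_A t`, `X`, and `⟨Z | E⟩`, where `E` has exactly
one equation `X = E X` for each `X` in the (possibly infinite) set `V`, and `Z ∈ V`. -/
inductive Term (Act : Type*) (Var : Type*) where
  | zero
  | bot
  | pre (α : Action Act) (t : Term Act Var)
  | ext (t s : Term Act Var)
  | conj (t s : Term Act Var)
  | disj (t s : Term Act Var)
  | par (A : Set Act) (t s : Term Act Var)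
  | var (X : Var)
  | fix (V : Set Var) (E : V → Term Act Var) (Z : V)

variable {Act Var : Type*}

namespace Term

/-- The free variables of a term; `fix V E Z` binds the variables in `V` in all bodies of `E`. -/
def fv : Term Act Var → Set Var
  | zero => ∅
  | bot => ∅
  | pre _ t => t.fv
  | ext t s => t.fv ∪ s.fv
  | conj t s => t.fv ∪ s.fv
  | disj t s => t.fv ∪ s.fv
  | par _ t s => t.fv ∪ s.fv
  | var X => {X}
  | fix V E _ => (⋃ Y, (E Y).fv) \ V

/-- Every free occurrence of `X` lies within a subterm `a.t` with `a` a visible action. -/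
def StronglyGuarded (X : Var) : Term Act Var → Prop
  | zero => True
  | bot => True
  | pre (.vis _) _ => True
  | pre .tau t => t.StronglyGuarded X
  | ext t s => t.StronglyGuarded X ∧ s.StronglyGuarded X
  | conj t s => t.StronglyGuarded X ∧ s.StronglyGuarded X
  | disj t s => t.StronglyGuarded X ∧ s.StronglyGuarded X
  | par _ t s => t.StronglyGuarded X ∧ s.StronglyGuarded X
  | var Y => Y ≠ X
  | fix V E _ => X ∈ V ∨ ∀ Y, (E Y).StronglyGuarded X

/-- Every free occurrence of `X` is strongly or weakly guarded, that is, it lies within a subterm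
`a.t` with `a` a visible action, or within a subterm `τ.t` or `t ∨ s`. -/
def GuardedIn (X : Var) : Term Act Var → Prop
  | zero => True
  | bot => True
  | pre _ _ => True
  | ext t s => t.GuardedIn X ∧ s.GuardedIn X
  | conj t s => t.GuardedIn X ∧ s.GuardedIn X
  | disj _ _ => True
  | par _ t s => t.GuardedIn X ∧ s.GuardedIn X
  | var Y => Y ≠ X
  | fix V E _ => X ∈ V ∨ ∀ Y, (E Y).GuardedIn X

/-- All recursive specifications that occur in the term are guarded. -/
def SpecsGuarded : Term Act Var → Prop
  | zero => True
  | bot => True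
  | pre _ t => t.SpecsGuarded
  | ext t s => t.SpecsGuarded ∧ s.SpecsGuarded
  | conj t s => t.SpecsGuarded ∧ s.SpecsGuarded
  | disj t s => t.SpecsGuarded ∧ s.SpecsGuarded
  | par _ t s => t.SpecsGuarded ∧ s.SpecsGuarded
  | var _ => True
  | fix V E _ => (∀ X Y : V, (E Y).GuardedIn (X : Var)) ∧ ∀ Y, (E Y).SpecsGuarded

open Classical in
/-- Simultaneous substitution of `σ X` for all free occurrences of each `X`. Bound variables are
not renamed: it is only used where each `σ X` is closed or is `X` itself, so that nothing can be
captured. -/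
noncomputable def subst : (Var → Term Act Var) → Term Act Var → Term Act Var
  | _, zero => zero
  | _, bot => bot
  | σ, pre α t => pre α (t.subst σ)
  | σ, ext t s => ext (t.subst σ) (s.subst σ)
  | σ, conj t s => conj (t.subst σ) (s.subst σ)
  | σ, disj t s => disj (t.subst σ) (s.subst σ)
  | σ, par A t s => par A (t.subst σ) (s.subst σ)
  | σ, var X => σ X
  | σ, fix V E Z => fix V (fun Y => (E Y).subst (fun X => if X ∈ V then var X else σ X)) Z

open Classical in
/-- The substitution `{⟨X | E⟩ / X : X ∈ V}`. -/
noncomputable def specSubst (V : Set Var) (E : V → Term Act Var) (X : Var) : Term Act Var :=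
  if h : X ∈ V then fix V E ⟨X, h⟩ else var X

/-- The term `⟨t_Z | E⟩`, where `Z = t_Z` is the equation of `Z` in `E`. -/
noncomputable def unfold (V : Set Var) (E : V → Term Act Var) (Z : V) : Term Act Var :=
  (E Z).subst (specSubst V E)

/-- The extended basic terms: `0`, `α.t`, `t □ t`, `t ∨ t`, `t ∥_A t`, `X`, and `⟨Z | E⟩` where
`E` is strongly guarded. The terms `⟨X | X = t⟩` are those in which `V = {X}`. -/
inductive ExtendedBasic : Term Act Var → Prop
  | zero : ExtendedBasic zero
  | pre (α : Action Act) {t : Term Act Var} : ExtendedBasic t → ExtendedBasic (pre α t)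
  | ext {t s : Term Act Var} : ExtendedBasic t → ExtendedBasic s → ExtendedBasic (ext t s)
  | disj {t s : Term Act Var} : ExtendedBasic t → ExtendedBasic s → ExtendedBasic (disj t s)
  | par (A : Set Act) {t s : Term Act Var} :
      ExtendedBasic t → ExtendedBasic s → ExtendedBasic (par A t s)
  | var (X : Var) : ExtendedBasic (var X)
  | fix {V : Set Var} {E : V → Term Act Var} (Z : V) :
      (∀ Y, ExtendedBasic (E Y)) → (∀ X Y : V, (E Y).StronglyGuarded (X : Var)) →
      ExtendedBasic (fix V E Z)

/-- A process is a closed term in which all recursive specifications are guarded. -/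
def IsProc (t : Term Act Var) : Prop := t.fv = ∅ ∧ t.SpecsGuarded

theorem fv_subst (t : Term Act Var) : ∀ (σ : Var → Term Act Var) (Y : Var),
    Y ∈ (t.subst σ).fv → ∃ X ∈ t.fv, Y ∈ (σ X).fv := by
  induction t with
  | zero => simp [subst, fv]
  | bot => simp [subst, fv]
  | pre α t ih => intro σ Y; simpa [subst, fv] using ih σ Y
  | ext t s iht ihs | conj t s iht ihs | disj t s iht ihs | par A t s iht ihs =>
    intro σ Y h
    simp only [subst, fv, Set.mem_union] at h ⊢
    rcases h with h | h
    · obtain ⟨X, hX, h⟩ := iht σ Y h; exact ⟨X, Or.inl hX, h⟩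
    · obtain ⟨X, hX, h⟩ := ihs σ Y h; exact ⟨X, Or.inr hX, h⟩
  | var X => intro σ Y h; exact ⟨X, rfl, h⟩
  | fix V E Z ih =>
    intro σ Y h
    simp only [subst, fv, Set.mem_sdiff, Set.mem_iUnion] at h ⊢
    obtain ⟨⟨W, hW⟩, hY⟩ := h
    obtain ⟨X, hX, hYX⟩ := ih W _ Y hW
    by_cases hXV : X ∈ V
    · simp only [hXV, if_true, fv, Set.mem_singleton_iff] at hYX
      exact absurd (hYX ▸ hXV) hY
    · simp only [hXV, if_false] at hYX
      exact ⟨X, ⟨⟨W, hX⟩, hXV⟩, hYX⟩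

theorem guardedIn_of_notMem_fv {X : Var} (t : Term Act Var) : X ∉ t.fv → t.GuardedIn X := by
  induction t with
  | zero | bot | pre | disj => intros; trivial
  | ext t s iht ihs | conj t s iht ihs | par A t s iht ihs =>
    intro h
    simp only [fv, Set.mem_union, not_or] at h
    exact ⟨iht h.1, ihs h.2⟩
  | var Y => intro h; simpa [fv, GuardedIn, eq_comm] using h
  | fix V E Z ih =>
    intro h
    simp only [fv, Set.mem_sdiff, Set.mem_iUnion, not_and, not_not] at h
    by_cases hX : X ∈ V
    · exact Or.inl hX
    · exact Or.inr fun Y => ih Y fun hY => hX (h ⟨Y, hY⟩)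

theorem fv_binder {V : Set Var} {σ : Var → Term Act Var} [DecidablePred (· ∈ V)]
    (hσ : ∀ Z, (σ Z).fv ⊆ {Z}) (Z : Var) :
    (if Z ∈ V then var Z else σ Z : Term Act Var).fv ⊆ {Z} := by
  split_ifs
  · simp [fv]
  · exact hσ Z

theorem GuardedIn.subst {X : Var} (t : Term Act Var) : ∀ (σ : Var → Term Act Var),
    (∀ Z, (σ Z).fv ⊆ {Z}) → t.GuardedIn X → (t.subst σ).GuardedIn X := by
  induction t with
  | zero | bot | pre | disj => intros; trivial
  | ext t s iht ihs | conj t s iht ihs | par A t s iht ihs =>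
    intro σ hσ h
    exact ⟨iht σ hσ h.1, ihs σ hσ h.2⟩
  | var Y =>
    intro σ hσ h
    exact guardedIn_of_notMem_fv _ fun hX => h (hσ Y hX).symm
  | fix V E Z ih =>
    intro σ hσ h
    exact h.imp id fun h Y => ih Y _ (fun Z => by classical exact fv_binder hσ Z) (h Y)

theorem SpecsGuarded.subst (t : Term Act Var) : ∀ (σ : Var → Term Act Var),
    (∀ Z, (σ Z).fv ⊆ {Z}) → (∀ Z, (σ Z).SpecsGuarded) → t.SpecsGuarded →
      (t.subst σ).SpecsGuarded := by
  induction t with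
  | zero | bot => intros; trivial
  | pre α t ih => intro σ hσ hg h; exact ih σ hσ hg h
  | ext t s iht ihs | conj t s iht ihs | disj t s iht ihs | par A t s iht ihs =>
    intro σ hσ hg h
    exact ⟨iht σ hσ hg h.1, ihs σ hσ hg h.2⟩
  | var Y => intro σ hσ hg h; exact hg Y
  | fix V E Z ih =>
    intro σ hσ hg h
    refine ⟨fun X Y => GuardedIn.subst _ _ (fun Z => by classical exact fv_binder hσ Z) (h.1 X Y),
      fun Y => ih Y _ (fun Z => by classical exact fv_binder hσ Z) (fun Z => ?_) (h.2 Y)⟩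
    split_ifs
    · trivial
    · exact hg Z

theorem IsProc.unfold {V : Set Var} {E : V → Term Act Var} {Z : V} (h : IsProc (fix V E Z)) :
    IsProc (unfold V E Z) := by
  have hfv : ∀ Y : V, (fix V E Y).fv = ∅ := fun Y => h.1
  constructor
  · rw [Set.eq_empty_iff_forall_notMem]
    intro Y hY
    obtain ⟨X, hX, hYX⟩ := fv_subst _ _ _ hY
    by_cases hXV : X ∈ V
    · simp only [specSubst, hXV, dif_pos, hfv] at hYX
      exact hYX
    · have : X ∈ (fix V E Z).fv := ⟨Set.mem_iUnion.2 ⟨Z, hX⟩, hXV⟩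
      rw [h.1] at this
      exact this
  · refine SpecsGuarded.subst _ _ (fun X => ?_) (fun X => ?_) (h.2.2 Z)
    · by_cases hXV : X ∈ V
      · simp [specSubst, hXV, hfv]
      · simp [specSubst, hXV, fv]
    · by_cases hXV : X ∈ V
      · simp only [specSubst, hXV, dif_pos]
        exact h.2
      · simp only [specSubst, hXV, dif_neg, not_false_iff]
        trivial

theorem StronglyGuarded.guardedIn {X : Var} (t : Term Act Var) :
    t.StronglyGuarded X → t.GuardedIn X := by
  induction t with
  | zero | bot | pre | disj => intros; trivial
  | ext t s iht ihs | conj t s iht ihs | par A t s iht ihs => exact fun h => ⟨iht h.1, ihs h.2⟩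
  | var Y => exact id
  | fix V E Z ih => exact fun h => h.imp id fun h Y => ih Y (h Y)

/-- A closed extended basic term is a process. -/
theorem ExtendedBasic.isProc {t : Term Act Var} (h : ExtendedBasic t) (hfv : t.fv = ∅) :
    IsProc t := by
  refine ⟨hfv, ?_⟩
  clear hfv
  induction h with
  | zero | var => trivial
  | pre α _ ih => exact ih
  | ext _ _ ih₁ ih₂ | disj _ _ ih₁ ih₂ | par A _ _ ih₁ ih₂ => exact ⟨ih₁, ih₂⟩
  | fix Z _ hg ih => exact ⟨fun X Y => StronglyGuarded.guardedIn _ (hg X Y), ih⟩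

end Term

/-- The processes of `CLL_R`. -/
abbrev Proc (Act Var : Type*) := {t : Term Act Var // t.IsProc}

namespace Proc

/-- The process `0`. -/
abbrev zero : Proc Act Var := ⟨.zero, rfl, trivial⟩

/-- The process `⊥`. -/
abbrev bot : Proc Act Var := ⟨.bot, rfl, trivial⟩

/-- The process `α.p`. -/
abbrev pre (α : Action Act) (p : Proc Act Var) : Proc Act Var := ⟨.pre α p.1, p.2⟩

/-- The process `p □ q`. -/
abbrev ext (p q : Proc Act Var) : Proc Act Var :=
  ⟨.ext p.1 q.1, by simp [Term.fv, p.2.1, q.2.1], p.2.2, q.2.2⟩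

/-- The process `p ∧ q`. -/
abbrev conj (p q : Proc Act Var) : Proc Act Var :=
  ⟨.conj p.1 q.1, by simp [Term.fv, p.2.1, q.2.1], p.2.2, q.2.2⟩

/-- The process `p ∨ q`. -/
abbrev disj (p q : Proc Act Var) : Proc Act Var :=
  ⟨.disj p.1 q.1, by simp [Term.fv, p.2.1, q.2.1], p.2.2, q.2.2⟩

/-- The process `p ∥_A q`. -/
abbrev par (A : Set Act) (p q : Proc Act Var) : Proc Act Var :=
  ⟨.par A p.1 q.1, by simp [Term.fv, p.2.1, q.2.1], p.2.2, q.2.2⟩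

end Proc

/-- Positive ground literals `p —α→ q` and `p F`. -/
inductive Literal (Act Var : Type*) where
  | trans (p : Proc Act Var) (α : Action Act) (q : Proc Act Var)
  | incons (p : Proc Act Var)

/-- `M ⊨ p —α↛`. -/
def Refuses (M : Set (Literal Act Var)) (p : Proc Act Var) (α : Action Act) : Prop :=
  ∀ q, Literal.trans p α q ∉ M

/-- `p ⟹ε| q` with respect to the transitions in `M`: `q` is reached from `p` by finitely many
(possibly zero) `τ`-transitions, and `q` has no `τ`-transition. -/
def StablyReaches (M : Set (Literal Act Var)) (p q : Proc Act Var) : Prop :=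
  Relation.ReflTransGen (fun r s => Literal.trans r .tau s ∈ M) p q ∧ Refuses M q .tau

open Literal in
/-- Provability in the stripped calculus `Strip(CLL_R, M)`: negative premises, and the index sets of
the premises `{y F : …}`, are evaluated in `M`; all other premises have to be proved. -/
inductive Strip (M : Set (Literal Act Var)) : Literal Act Var → Prop
  | ra1 (α : Action Act) (x₁ : Proc Act Var) : Strip M (trans (.pre α x₁) α x₁)
  | ra2 {a : Act} {x₁ x₂ y₁ : Proc Act Var} : Strip M (trans x₁ (.vis a) y₁) →
      Refuses M x₂ .tau → Strip M (trans (.ext x₁ x₂) (.vis a) y₁)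
  | ra3 {a : Act} {x₁ x₂ y₂ : Proc Act Var} : Refuses M x₁ .tau →
      Strip M (trans x₂ (.vis a) y₂) → Strip M (trans (.ext x₁ x₂) (.vis a) y₂)
  | ra4 {x₁ x₂ y₁ : Proc Act Var} : Strip M (trans x₁ .tau y₁) →
      Strip M (trans (.ext x₁ x₂) .tau (.ext y₁ x₂))
  | ra5 {x₁ x₂ y₂ : Proc Act Var} : Strip M (trans x₂ .tau y₂) →
      Strip M (trans (.ext x₁ x₂) .tau (.ext x₁ y₂))
  | ra6 {a : Act} {x₁ x₂ y₁ y₂ : Proc Act Var} : Strip M (trans x₁ (.vis a) y₁) →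
      Strip M (trans x₂ (.vis a) y₂) → Strip M (trans (.conj x₁ x₂) (.vis a) (.conj y₁ y₂))
  | ra7 {x₁ x₂ y₁ : Proc Act Var} : Strip M (trans x₁ .tau y₁) →
      Strip M (trans (.conj x₁ x₂) .tau (.conj y₁ x₂))
  | ra8 {x₁ x₂ y₂ : Proc Act Var} : Strip M (trans x₂ .tau y₂) →
      Strip M (trans (.conj x₁ x₂) .tau (.conj x₁ y₂))
  | ra9 (x₁ x₂ : Proc Act Var) : Strip M (trans (.disj x₁ x₂) .tau x₁)
  | ra10 (x₁ x₂ : Proc Act Var) : Strip M (trans (.disj x₁ x₂) .tau x₂)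
  | ra11 {A : Set Act} {x₁ x₂ y₁ : Proc Act Var} : Strip M (trans x₁ .tau y₁) →
      Strip M (trans (.par A x₁ x₂) .tau (.par A y₁ x₂))
  | ra12 {A : Set Act} {x₁ x₂ y₂ : Proc Act Var} : Strip M (trans x₂ .tau y₂) →
      Strip M (trans (.par A x₁ x₂) .tau (.par A x₁ y₂))
  | ra13 {A : Set Act} {a : Act} {x₁ x₂ y₁ : Proc Act Var} : a ∉ A →
      Strip M (trans x₁ (.vis a) y₁) → Refuses M x₂ .tau →
      Strip M (trans (.par A x₁ x₂) (.vis a) (.par A y₁ x₂))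
  | ra14 {A : Set Act} {a : Act} {x₁ x₂ y₂ : Proc Act Var} : a ∉ A →
      Refuses M x₁ .tau → Strip M (trans x₂ (.vis a) y₂) →
      Strip M (trans (.par A x₁ x₂) (.vis a) (.par A x₁ y₂))
  | ra15 {A : Set Act} {a : Act} {x₁ x₂ y₁ y₂ : Proc Act Var} : a ∈ A →
      Strip M (trans x₁ (.vis a) y₁) → Strip M (trans x₂ (.vis a) y₂) →
      Strip M (trans (.par A x₁ x₂) (.vis a) (.par A y₁ y₂))
  | ra16 {V : Set Var} {E : V → Term Act Var} {X : V} (h : (Term.fix V E X).IsProc)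
      {α : Action Act} {y : Proc Act Var} : Strip M (trans ⟨.unfold V E X, h.unfold⟩ α y) →
      Strip M (trans ⟨.fix V E X, h⟩ α y)
  | rp1 : Strip M (incons .bot)
  | rp2 {α : Action Act} {x₁ : Proc Act Var} : Strip M (incons x₁) →
      Strip M (incons (.pre α x₁))
  | rp3 {x₁ x₂ : Proc Act Var} : Strip M (incons x₁) → Strip M (incons x₂) →
      Strip M (incons (.disj x₁ x₂))
  | rp4 {x₁ x₂ : Proc Act Var} : Strip M (incons x₁) → Strip M (incons (.ext x₁ x₂))
  | rp5 {x₁ x₂ : Proc Act Var} : Strip M (incons x₂) → Strip M (incons (.ext x₁ x₂))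
  | rp6 {A : Set Act} {x₁ x₂ : Proc Act Var} : Strip M (incons x₁) →
      Strip M (incons (.par A x₁ x₂))
  | rp7 {A : Set Act} {x₁ x₂ : Proc Act Var} : Strip M (incons x₂) →
      Strip M (incons (.par A x₁ x₂))
  | rp8 {x₁ x₂ : Proc Act Var} : Strip M (incons x₁) → Strip M (incons (.conj x₁ x₂))
  | rp9 {x₁ x₂ : Proc Act Var} : Strip M (incons x₂) → Strip M (incons (.conj x₁ x₂))
  | rp10 {a : Act} {x₁ x₂ y₁ : Proc Act Var} : Strip M (trans x₁ (.vis a) y₁) →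
      Refuses M x₂ (.vis a) → Refuses M (.conj x₁ x₂) .tau → Strip M (incons (.conj x₁ x₂))
  | rp11 {a : Act} {x₁ x₂ y₂ : Proc Act Var} : Refuses M x₁ (.vis a) →
      Strip M (trans x₂ (.vis a) y₂) → Refuses M (.conj x₁ x₂) .tau →
      Strip M (incons (.conj x₁ x₂))
  | rp12 {α : Action Act} {x₁ x₂ z : Proc Act Var} : Strip M (trans (.conj x₁ x₂) α z) →
      (∀ y, trans (.conj x₁ x₂) α y ∈ M → Strip M (incons y)) → Strip M (incons (.conj x₁ x₂))
  | rp13 {x₁ x₂ : Proc Act Var} :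
      (∀ y, StablyReaches M (.conj x₁ x₂) y → Strip M (incons y)) →
      Strip M (incons (.conj x₁ x₂))
  | rp14 {V : Set Var} {E : V → Term Act Var} {X : V} (h : (Term.fix V E X).IsProc) :
      Strip M (incons ⟨.unfold V E X, h.unfold⟩) → Strip M (incons ⟨.fix V E X, h⟩)
  | rp15 {V : Set Var} {E : V → Term Act Var} {X : V} (h : (Term.fix V E X).IsProc) :
      (∀ y, StablyReaches M ⟨.fix V E X, h⟩ y → Strip M (incons y)) →
      Strip M (incons ⟨.fix V E X, h⟩)

/-- A stable transition model consists exactly of the literals provable in its stripped calculus. -/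
def IsStableModel (M : Set (Literal Act Var)) : Prop := M = {l | Strip M l}

theorem strip_tau {M N : Set (Literal Act Var)} {l : Literal Act Var} (h : Strip M l) :
    ∀ p q, l = .trans p .tau q → Strip N l := by
  induction h <;> rintro p q heq <;> cases heq
  case ra1 => exact .ra1 _ _
  case ra4 ih => exact .ra4 (ih _ _ rfl)
  case ra5 ih => exact .ra5 (ih _ _ rfl)
  case ra7 ih => exact .ra7 (ih _ _ rfl)
  case ra8 ih => exact .ra8 (ih _ _ rfl)
  case ra9 => exact .ra9 _ _
  case ra10 => exact .ra10 _ _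
  case ra11 ih => exact .ra11 (ih _ _ rfl)
  case ra12 ih => exact .ra12 (ih _ _ rfl)
  case ra16 h _ _ ih => exact .ra16 _ (ih _ _ rfl)

theorem strip_trans {M N : Set (Literal Act Var)} (hMN : ∀ p, Refuses M p .tau → Refuses N p .tau)
    {l : Literal Act Var} (h : Strip M l) : ∀ p α q, l = .trans p α q → Strip N l := by
  induction h <;> rintro p α q heq <;> cases heq
  case ra1 => exact .ra1 _ _
  case ra2 hr ih => exact .ra2 (ih _ _ _ rfl) (hMN _ hr)
  case ra3 hr _ ih => exact .ra3 (hMN _ hr) (ih _ _ _ rfl)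
  case ra4 ih => exact .ra4 (ih _ _ _ rfl)
  case ra5 ih => exact .ra5 (ih _ _ _ rfl)
  case ra6 ih₁ ih₂ => exact .ra6 (ih₁ _ _ _ rfl) (ih₂ _ _ _ rfl)
  case ra7 ih => exact .ra7 (ih _ _ _ rfl)
  case ra8 ih => exact .ra8 (ih _ _ _ rfl)
  case ra9 => exact .ra9 _ _
  case ra10 => exact .ra10 _ _
  case ra11 ih => exact .ra11 (ih _ _ _ rfl)
  case ra12 ih => exact .ra12 (ih _ _ _ rfl)
  case ra13 ha _ hr ih => exact .ra13 ha (ih _ _ _ rfl) (hMN _ hr)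
  case ra14 ha hr _ ih => exact .ra14 ha (hMN _ hr) (ih _ _ _ rfl)
  case ra15 ha _ _ ih₁ ih₂ => exact .ra15 ha (ih₁ _ _ _ rfl) (ih₂ _ _ _ rfl)
  case ra16 h _ _ ih => exact .ra16 _ (ih _ _ _ rfl)

theorem strip_all {M N : Set (Literal Act Var)}
    (hMN : ∀ p α q, Literal.trans p α q ∈ M ↔ Literal.trans p α q ∈ N)
    {l : Literal Act Var} (h : Strip M l) : Strip N l := by
  have hr : ∀ p α, Refuses M p α → Refuses N p α := fun p α h q hq => h q ((hMN p α q).2 hq)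
  have hs : ∀ p q, StablyReaches N p q → StablyReaches M p q := fun p q h =>
    ⟨Relation.ReflTransGen.mono (fun a b => (hMN a .tau b).2) _ _ h.1, fun r hq => h.2 r ((hMN q .tau r).1 hq)⟩
  have ht : ∀ {p α q}, Strip M (.trans p α q) → Strip N (.trans p α q) := fun h =>
    strip_trans (fun p => hr p .tau) h _ _ _ rfl
  induction h
  case rp1 => exact .rp1
  case rp2 ih => exact .rp2 ih
  case rp3 ih₁ ih₂ => exact .rp3 ih₁ ih₂
  case rp4 ih => exact .rp4 ih
  case rp5 ih => exact .rp5 ih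
  case rp6 ih => exact .rp6 ih
  case rp7 ih => exact .rp7 ih
  case rp8 ih => exact .rp8 ih
  case rp9 ih => exact .rp9 ih
  case rp10 h₁ h₂ ih => exact .rp10 ih (hr _ _ h₁) (hr _ _ h₂)
  case rp11 h₁ _ h₂ ih => exact .rp11 (hr _ _ h₁) ih (hr _ _ h₂)
  case rp12 _ ih₁ ih₂ => exact .rp12 ih₁ fun y hy => ih₂ y ((hMN _ _ _).2 hy)
  case rp13 ih => exact .rp13 fun y hy => ih y (hs _ _ hy)
  case rp14 h _ ih => exact .rp14 h ih
  case rp15 h _ ih => exact .rp15 h fun y hy => ih y (hs _ _ hy)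
  all_goals
    apply ht
    first
    | exact .ra2 ‹_› ‹_›
    | exact .ra3 ‹_› ‹_›
    | exact .ra13 ‹_› ‹_› ‹_›
    | exact .ra14 ‹_› ‹_› ‹_›
    | (constructor <;> assumption)

/-- `CLL_R` has a unique stable transition model. -/
theorem existsUnique_isStableModel (Act Var : Type*) :
    ∃! M : Set (Literal Act Var), IsStableModel M := by
  let S : Set (Literal Act Var) → Set (Literal Act Var) := fun M => {l | Strip M l}
  have h1 : ∀ M N p q, Literal.trans p .tau q ∈ S M → Literal.trans p .tau q ∈ S N :=
    fun M N p q h => strip_tau h _ _ rfl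
  have h2 : ∀ M N p α q, Literal.trans p α q ∈ S (S M) → Literal.trans p α q ∈ S (S N) :=
    fun M N p α q h => strip_trans (fun p hp q hq => hp q (h1 _ _ _ _ hq)) h _ _ _ rfl
  have h3 : ∀ M N, S (S (S M)) = S (S (S N)) := fun M N => Set.Subset.antisymm
    (fun l h => strip_all (fun p α q => ⟨h2 _ _ p α q, h2 _ _ p α q⟩) h)
    (fun l h => strip_all (fun p α q => ⟨h2 _ _ p α q, h2 _ _ p α q⟩) h)
  refine ⟨S (S (S ∅)), h3 ∅ (S ∅), fun M (hM : M = S M) => ?_⟩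
  have : M = S (S (S M)) := by rw [← hM, ← hM, ← hM]
  rw [this]
  exact h3 _ _

/-- The stable transition model `M_{CLL_R}`. -/
noncomputable def model (Act Var : Type*) : Set (Literal Act Var) :=
  (existsUnique_isStableModel Act Var).choose

/-- The inconsistency predicate `F`, as a set of (closed) terms. -/
def inconsistent (Act Var : Type*) : Set (Term Act Var) :=
  {t | ∃ h : t.IsProc, Literal.incons ⟨t, h⟩ ∈ model Act Var}

/-- `ET(Σ_B)`, the set of all extended basic terms. -/
def extendedBasicTerms (Act Var : Type*) : Set (Term Act Var) :=
  {t | t.ExtendedBasic}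

end CLLR

namespace CLLR

variable {Act Var : Type*}

/-! ### Substitution, strong guardedness and extended basic terms. -/

namespace Term

/-! Inconsistency is derivable only by finitary or infinitary rules, so one inducts on a derivation
of `p F` and shows that `p` cannot be extended basic. The constant `⊥` and conjunctions are excluded
by the grammar, and the rules for the other operators pass to extended basic components or to an
unfolding, which is again extended basic. The only dangerous rule is `rp15`: its premises range over
the stable processes that `⟨X | E⟩` reaches by `τ`-steps, and with no such process it would hold
vacuously.

So the core is `IsStableModel.exists_stablyReaches`: every extended basic process reaches a stable
one. Unfolding a recursion does not make the term smaller, so the induction runs over open terms `t`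
under a substitution `σ`. The assumption that `σ X` reaches a stable process is made only for those
`X` that are not strongly guarded in `t`, since a visible prefix is stable whatever stands below it.
The unfolding of `⟨Z | E⟩` is an instance of the body of `Z`, a genuine subterm in which all
variables bound by `E` are strongly guarded. Hence nothing need be known about the `⟨X | E⟩`
substituted for them, and there is no circularity. -/

theorem subst_congr (t : Term Act Var) : ∀ {σ ρ : Var → Term Act Var},
    (∀ X ∈ t.fv, σ X = ρ X) → t.subst σ = t.subst ρ := by
  induction t with
  | zero | bot => intros; rfl
  | pre α t ih => intro σ ρ h; simp only [subst]; rw [ih h]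
  | ext t s iht ihs | conj t s iht ihs | disj t s iht ihs | par A t s iht ihs =>
    intro σ ρ h
    simp only [subst]
    rw [iht fun X hX => h X (Or.inl hX), ihs fun X hX => h X (Or.inr hX)]
  | var X => intro σ ρ h; exact h X rfl
  | fix V E Z ih =>
    intro σ ρ h
    simp only [subst]
    congr 1
    funext Y
    refine ih Y fun X hX => ?_
    split_ifs with hXV
    · rfl
    · exact h X ⟨Set.mem_iUnion.2 ⟨Y, hX⟩, hXV⟩

theorem subst_eq_self {t : Term Act Var} : ∀ {σ : Var → Term Act Var},
    (∀ X ∈ t.fv, σ X = var X) → t.subst σ = t := by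
  induction t with
  | zero | bot => intros; rfl
  | pre α t ih => intro σ h; simp only [subst]; rw [ih h]
  | ext t s iht ihs | conj t s iht ihs | disj t s iht ihs | par A t s iht ihs =>
    intro σ h
    simp only [subst]
    rw [iht fun X hX => h X (Or.inl hX), ihs fun X hX => h X (Or.inr hX)]
  | var X => intro σ h; exact h X rfl
  | fix V E Z ih =>
    intro σ h
    simp only [subst]
    congr 1
    funext Y
    refine ih Y fun X hX => ?_
    split_ifs with hXV
    · rfl
    · exact h X ⟨Set.mem_iUnion.2 ⟨Y, hX⟩, hXV⟩

/-- The bound on the free variables of `σ Z` excludes capture: under a binder of `V`, a term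
substituted for `X ∉ V` mentions no variable of `V`, so `ρ` and its restriction agree on it. -/
theorem subst_subst (t : Term Act Var) : ∀ {σ ρ : Var → Term Act Var},
    (∀ Z, (σ Z).fv ⊆ {Z}) → (t.subst σ).subst ρ = t.subst fun X => (σ X).subst ρ := by
  induction t with
  | zero | bot => intros; rfl
  | pre α t ih => intro σ ρ h; simp only [subst]; rw [ih h]
  | ext t s iht ihs | conj t s iht ihs | disj t s iht ihs | par A t s iht ihs =>
    intro σ ρ h
    simp only [subst]
    rw [iht h, ihs h]
  | var X => intros; rfl
  | fix V E Z ih =>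
    intro σ ρ h
    simp only [subst]
    congr 1
    funext Y
    rw [ih Y fun Z => by classical exact fv_binder h Z]
    congr 1
    funext X
    by_cases hXV : X ∈ V
    · simp [hXV, subst]
    · simp only [hXV, if_false]
      refine subst_congr _ fun W hW => ?_
      obtain rfl : W = X := h X hW
      simp [hXV]

theorem stronglyGuarded_of_notMem_fv {X : Var} (t : Term Act Var) :
    X ∉ t.fv → t.StronglyGuarded X := by
  induction t with
  | zero | bot => intros; trivial
  | pre α t ih =>
    intro h
    cases α
    · trivial
    · exact ih h
  | ext t s iht ihs | conj t s iht ihs | disj t s iht ihs | par A t s iht ihs =>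
    intro h
    simp only [fv, Set.mem_union, not_or] at h
    exact ⟨iht h.1, ihs h.2⟩
  | var Y => intro h; simpa [fv, StronglyGuarded, eq_comm] using h
  | fix V E Z ih =>
    intro h
    simp only [fv, Set.mem_sdiff, Set.mem_iUnion, not_and, not_not] at h
    by_cases hX : X ∈ V
    · exact Or.inl hX
    · exact Or.inr fun Y => ih Y fun hY => hX (h ⟨Y, hY⟩)

/-- By the bound on free variables, no variable other than `X` is replaced by a term containing `X`,
so no unguarded occurrence of `X` can arise. -/
theorem StronglyGuarded.subst {X : Var} (t : Term Act Var) : ∀ (σ : Var → Term Act Var),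
    (∀ Z, (σ Z).fv ⊆ {Z}) → t.StronglyGuarded X → (t.subst σ).StronglyGuarded X := by
  induction t with
  | zero | bot => intros; trivial
  | pre α t ih =>
    intro σ hσ h
    cases α
    · trivial
    · exact ih σ hσ h
  | ext t s iht ihs | conj t s iht ihs | disj t s iht ihs | par A t s iht ihs =>
    intro σ hσ h
    exact ⟨iht σ hσ h.1, ihs σ hσ h.2⟩
  | var Y =>
    intro σ hσ h
    exact stronglyGuarded_of_notMem_fv _ fun hX => h (hσ Y hX).symm
  | fix V E Z ih =>
    intro σ hσ h
    exact h.imp id fun h Y => ih Y _ (fun Z => by classical exact fv_binder hσ Z) (h Y)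

theorem ExtendedBasic.subst {t : Term Act Var} (ht : ExtendedBasic t) :
    ∀ {σ : Var → Term Act Var}, (∀ Z, (σ Z).fv ⊆ {Z}) → (∀ Z, ExtendedBasic (σ Z)) →
      ExtendedBasic (t.subst σ) := by
  induction ht with
  | zero => intros; exact .zero
  | pre α _ ih => intro σ hσ hb; exact .pre α (ih hσ hb)
  | ext _ _ ih₁ ih₂ => intro σ hσ hb; exact .ext (ih₁ hσ hb) (ih₂ hσ hb)
  | disj _ _ ih₁ ih₂ => intro σ hσ hb; exact .disj (ih₁ hσ hb) (ih₂ hσ hb)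
  | par A _ _ ih₁ ih₂ => intro σ hσ hb; exact .par A (ih₁ hσ hb) (ih₂ hσ hb)
  | var X => intro σ hσ hb; exact hb X
  | @fix V E Z _ hg ih =>
    intro σ hσ hb
    refine .fix Z (fun Y => ih Y (fun Z => by classical exact fv_binder hσ Z) fun W => ?_)
      fun X Y => StronglyGuarded.subst _ _ (fun Z => by classical exact fv_binder hσ Z) (hg X Y)
    split_ifs
    · exact .var W
    · exact hb W

theorem specSubst_fv {V : Set Var} {E : V → Term Act Var} {Z : V} (h : (fix V E Z).fv = ∅)
    (X : Var) : (specSubst V E X).fv ⊆ {X} := by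
  by_cases hX : X ∈ V
  · have h' : (fix V E ⟨X, hX⟩).fv = ∅ := h
    simp [specSubst, hX, h']
  · simp [specSubst, hX, fv]

theorem ExtendedBasic.unfold {V : Set Var} {E : V → Term Act Var} {Z : V}
    (hb : ExtendedBasic (Term.fix V E Z)) (h : (Term.fix V E Z).fv = ∅) :
    ExtendedBasic (Term.unfold V E Z) := by
  cases hb with
  | fix _ hE hg =>
    refine (hE Z).subst (specSubst_fv h) fun X => ?_
    by_cases hX : X ∈ V
    · simpa [specSubst, hX] using ExtendedBasic.fix ⟨X, hX⟩ hE hg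
    · simpa [specSubst, hX] using ExtendedBasic.var X

end Term

/-! ### Transitions of extended basic processes and inversion of `τ`-steps. -/

section Tau

variable {M : Set (Literal Act Var)}

/-- Transitions preserve extended basic terms. -/
theorem Strip.extendedBasic {l : Literal Act Var} (h : Strip M l) :
    ∀ p α q, l = .trans p α q → p.1.ExtendedBasic → q.1.ExtendedBasic := by
  induction h <;> rintro p α q heq hb <;> cases heq
  case ra1 => cases hb; assumption
  case ra2 ih => cases hb with | ext h₁ h₂ => exact ih _ _ _ rfl h₁
  case ra3 ih => cases hb with | ext h₁ h₂ => exact ih _ _ _ rfl h₂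
  case ra4 ih => cases hb with | ext h₁ h₂ => exact .ext (ih _ _ _ rfl h₁) h₂
  case ra5 ih => cases hb with | ext h₁ h₂ => exact .ext h₁ (ih _ _ _ rfl h₂)
  case ra6 => cases hb
  case ra7 => cases hb
  case ra8 => cases hb
  case ra9 => cases hb; assumption
  case ra10 => cases hb; assumption
  case ra11 ih => cases hb with | par _ h₁ h₂ => exact .par _ (ih _ _ _ rfl h₁) h₂
  case ra12 ih => cases hb with | par _ h₁ h₂ => exact .par _ h₁ (ih _ _ _ rfl h₂)
  case ra13 ih => cases hb with | par _ h₁ h₂ => exact .par _ (ih _ _ _ rfl h₁) h₂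
  case ra14 ih => cases hb with | par _ h₁ h₂ => exact .par _ h₁ (ih _ _ _ rfl h₂)
  case ra15 ih₁ ih₂ =>
    cases hb with | par _ h₁ h₂ => exact .par _ (ih₁ _ _ _ rfl h₁) (ih₂ _ _ _ rfl h₂)
  case ra16 h _ _ _ ih => exact ih _ _ _ rfl (hb.unfold h.1)

theorem Strip.not_tau_zero {q : Proc Act Var} : ¬ Strip M (.trans .zero .tau q) := by
  intro h
  -- The shape of the source is kept as an equation between underlying terms, where distinctness of
  -- constructors rules out every transition rule.
  generalize hp : (Proc.zero : Proc Act Var) = p at h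
  replace hp : Term.zero = p.1 := congrArg Subtype.val hp
  cases h <;> cases hp

theorem Strip.not_tau_pre_vis {a : Act} {x q : Proc Act Var} :
    ¬ Strip M (.trans (.pre (.vis a) x) .tau q) := by
  intro h
  generalize hp : Proc.pre (.vis a) x = p at h
  replace hp : Term.pre (.vis a) x.1 = p.1 := congrArg Subtype.val hp
  cases h <;> injection hp
  case ra1 h _ => cases h

theorem Strip.tau_ext {x₁ x₂ q : Proc Act Var} (h : Strip M (.trans (.ext x₁ x₂) .tau q)) :
    (∃ y, Strip M (.trans x₁ .tau y)) ∨ ∃ y, Strip M (.trans x₂ .tau y) := by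
  generalize hp : Proc.ext x₁ x₂ = p at h
  replace hp : Term.ext x₁.1 x₂.1 = p.1 := congrArg Subtype.val hp
  cases h <;> injection hp
  case ra4 h h₁ h₂ => exact Or.inl ⟨_, Subtype.ext h₁ ▸ h⟩
  case ra5 h h₁ h₂ => exact Or.inr ⟨_, Subtype.ext h₂ ▸ h⟩

theorem Strip.tau_par {A : Set Act} {x₁ x₂ q : Proc Act Var}
    (h : Strip M (.trans (.par A x₁ x₂) .tau q)) :
    (∃ y, Strip M (.trans x₁ .tau y)) ∨ ∃ y, Strip M (.trans x₂ .tau y) := by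
  generalize hp : Proc.par A x₁ x₂ = p at h
  replace hp : Term.par A x₁.1 x₂.1 = p.1 := congrArg Subtype.val hp
  cases h <;> injection hp
  case ra11 h _ h₁ h₂ => exact Or.inl ⟨_, Subtype.ext h₁ ▸ h⟩
  case ra12 h _ h₁ h₂ => exact Or.inr ⟨_, Subtype.ext h₂ ▸ h⟩

theorem IsStableModel.mem_iff (hM : IsStableModel M) {l : Literal Act Var} : l ∈ M ↔ Strip M l := by
  conv_lhs => rw [hM]
  rfl

/-! ### Reaching stable processes, and consistency. -/

/-- The left component is run to stability, then the right one; `τ`-steps of either leave the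
operator in place, and the result has no `τ`-step of its own. -/
theorem IsStableModel.stablyReaches_ext (hM : IsStableModel M) {x₁ x₂ y₁ y₂ : Proc Act Var}
    (h₁ : StablyReaches M x₁ y₁) (h₂ : StablyReaches M x₂ y₂) :
    StablyReaches M (.ext x₁ x₂) (.ext y₁ y₂) := by
  refine ⟨(h₁.1.lift (Proc.ext · x₂) fun a b h => ?_).trans
    (h₂.1.lift (Proc.ext y₁ ·) fun a b h => ?_), fun q hq => ?_⟩
  · exact hM.mem_iff.2 (.ra4 (hM.mem_iff.1 h))
  · exact hM.mem_iff.2 (.ra5 (hM.mem_iff.1 h))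
  · rcases (hM.mem_iff.1 hq).tau_ext with ⟨y, hy⟩ | ⟨y, hy⟩
    · exact h₁.2 y (hM.mem_iff.2 hy)
    · exact h₂.2 y (hM.mem_iff.2 hy)

theorem IsStableModel.stablyReaches_par (hM : IsStableModel M) (A : Set Act)
    {x₁ x₂ y₁ y₂ : Proc Act Var}
    (h₁ : StablyReaches M x₁ y₁) (h₂ : StablyReaches M x₂ y₂) :
    StablyReaches M (.par A x₁ x₂) (.par A y₁ y₂) := by
  refine ⟨(h₁.1.lift (Proc.par A · x₂) fun a b h => ?_).trans
    (h₂.1.lift (Proc.par A y₁ ·) fun a b h => ?_), fun q hq => ?_⟩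
  · exact hM.mem_iff.2 (.ra11 (hM.mem_iff.1 h))
  · exact hM.mem_iff.2 (.ra12 (hM.mem_iff.1 h))
  · rcases (hM.mem_iff.1 hq).tau_par with ⟨y, hy⟩ | ⟨y, hy⟩
    · exact h₁.2 y (hM.mem_iff.2 hy)
    · exact h₂.2 y (hM.mem_iff.2 hy)

/-- A recursion has the transitions of its unfolding but is a different process: if the unfolding is
already stable, the stable process reached is the recursion itself. -/
theorem IsStableModel.exists_stablyReaches_fix (hM : IsStableModel M)
    {V : Set Var} {E : V → Term Act Var} {X : V}
    (h : (Term.fix V E X).IsProc) (hu : ∃ q, StablyReaches M ⟨.unfold V E X, h.unfold⟩ q) :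
    ∃ q, StablyReaches M ⟨.fix V E X, h⟩ q := by
  obtain ⟨q, hq, hs⟩ := hu
  rcases Relation.ReflTransGen.cases_head hq with rfl | ⟨r, hr, hrq⟩
  · refine ⟨_, .refl, fun r hr => ?_⟩
    cases hM.mem_iff.1 hr with
    | ra16 _ h => exact hs r (hM.mem_iff.2 h)
  · exact ⟨q, .head (hM.mem_iff.2 (.ra16 h (hM.mem_iff.1 hr))) hrq, hs⟩

/-- Each closed instance of an extended basic term reaches a stable process, provided that the
processes substituted for the variables that are not strongly guarded do. -/
theorem IsStableModel.exists_stablyReaches_subst (hM : IsStableModel M)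
    {t : Term Act Var} (ht : t.ExtendedBasic) :
    ∀ {σ : Var → Term Act Var}, (∀ Z, (σ Z).fv ⊆ {Z}) →
      (∀ X, t.StronglyGuarded X ∨ ∀ h : (σ X).IsProc, ∃ q, StablyReaches M ⟨σ X, h⟩ q) →
      ∀ h : (t.subst σ).IsProc, ∃ q, StablyReaches M ⟨t.subst σ, h⟩ q := by
  induction ht with
  | zero =>
    intro σ _ _ h
    exact ⟨_, .refl, fun q hq => Strip.not_tau_zero (hM.mem_iff.1 hq)⟩
  | @pre α t _ ih =>
    intro σ hσ hg h
    cases α with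
    | vis a =>
      -- Stable with no assumption on `σ`; this is why strongly guarded variables can be exempted.
      exact ⟨_, .refl, fun q hq => Strip.not_tau_pre_vis (x := ⟨t.subst σ, h⟩) (hM.mem_iff.1 hq)⟩
    | tau =>
      obtain ⟨q, hq, hs⟩ := ih hσ hg h
      exact ⟨q, .head (hM.mem_iff.2 (.ra1 .tau ⟨t.subst σ, h⟩)) hq, hs⟩
  | ext _ _ ih₁ ih₂ =>
    intro σ hσ hg h
    have hfv := Set.union_empty_iff.1 h.1
    obtain ⟨q₁, h₁⟩ := ih₁ hσ (fun X => (hg X).imp And.left id) ⟨hfv.1, h.2.1⟩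
    obtain ⟨q₂, h₂⟩ := ih₂ hσ (fun X => (hg X).imp And.right id) ⟨hfv.2, h.2.2⟩
    exact ⟨_, hM.stablyReaches_ext h₁ h₂⟩
  | @disj t s _ _ ih₁ ih₂ =>
    intro σ hσ hg h
    have hfv := Set.union_empty_iff.1 h.1
    obtain ⟨q, hq, hs⟩ := ih₁ hσ (fun X => (hg X).imp And.left id) ⟨hfv.1, h.2.1⟩
    exact ⟨q, .head (hM.mem_iff.2
      (.ra9 ⟨t.subst σ, hfv.1, h.2.1⟩ ⟨s.subst σ, hfv.2, h.2.2⟩)) hq, hs⟩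
  | par A _ _ ih₁ ih₂ =>
    intro σ hσ hg h
    have hfv := Set.union_empty_iff.1 h.1
    obtain ⟨q₁, h₁⟩ := ih₁ hσ (fun X => (hg X).imp And.left id) ⟨hfv.1, h.2.1⟩
    obtain ⟨q₂, h₂⟩ := ih₂ hσ (fun X => (hg X).imp And.right id) ⟨hfv.2, h.2.2⟩
    exact ⟨_, hM.stablyReaches_par A h₁ h₂⟩
  | var X =>
    intro σ hσ hg h
    rcases hg X with hX | hX
    · exact absurd rfl hX
    · exact hX h
  | @fix V E Z _ hgE ih =>
    intro σ hσ hg h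
    refine hM.exists_stablyReaches_fix h ?_
    classical
    have hfvσ : ∀ W, (if W ∈ V then Term.var W else σ W : Term Act Var).fv ⊆ {W} :=
      fun W => Term.fv_binder hσ W
    have hspec := Term.specSubst_fv h.1
    -- The term is freed from its proof of being a process, so that the two nested substitutions can
    -- be merged into one acting on `E Z`.
    suffices H : ∀ u (hu : Term.IsProc u), u = Term.unfold V (fun Y =>
        (E Y).subst fun X => if X ∈ V then Term.var X else σ X) Z →
        ∃ q, StablyReaches M ⟨u, hu⟩ q from H _ h.unfold rfl
    rintro u hu rfl
    revert hu
    rw [Term.unfold, Term.subst_subst _ hfvσ]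
    refine ih Z (fun W X hX => ?_) fun X => ?_
    · obtain ⟨Y, hY, hXY⟩ := Term.fv_subst _ _ _ hX
      obtain rfl : Y = W := hfvσ W hY
      exact hspec Y hXY
    · by_cases hXV : X ∈ V
      · exact Or.inl (hgE ⟨X, hXV⟩ Z)
      · refine (hg X).imp (fun hX => (hX.resolve_left hXV) Z) fun hX => ?_
        -- For `X ∉ V` the outer substitution fixes `σ X`, whose only possible free variable is `X`.
        rw [if_neg hXV, Term.subst_eq_self fun W hW => ?_]
        · exact hX
        · obtain rfl : W = X := hσ X hW
          simp [Term.specSubst, hXV]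

/-- Each extended basic process reaches a stable process. -/
theorem IsStableModel.exists_stablyReaches (hM : IsStableModel M)
    {p : Proc Act Var} (hp : p.1.ExtendedBasic) :
    ∃ q, StablyReaches M p q := by
  have hvar : ∀ Z : Var, (Term.var Z : Term Act Var).fv ⊆ {Z} := fun Z => subset_rfl
  have hself : p.1.subst Term.var = p.1 := Term.subst_eq_self fun X _ => rfl
  -- Under the identity substitution the assumption on variables is vacuous, as a variable is not
  -- closed.
  have H := hM.exists_stablyReaches_subst hp hvar fun X => Or.inr fun h =>
    absurd h.1 (Set.singleton_ne_empty X)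
  rw [hself] at H
  exact H p.2

theorem IsStableModel.extendedBasic_of_stablyReaches (hM : IsStableModel M) {p q : Proc Act Var}
    (h : StablyReaches M p q) (hp : p.1.ExtendedBasic) : q.1.ExtendedBasic := by
  obtain ⟨h, -⟩ := h
  induction h with
  | refl => exact hp
  | tail _ h ih => exact (hM.mem_iff.1 h).extendedBasic _ _ _ rfl ih

/-- Extended basic processes are consistent. -/
theorem IsStableModel.not_incons (hM : IsStableModel M) {l : Literal Act Var} (h : Strip M l) :
    ∀ p, l = .incons p → ¬ p.1.ExtendedBasic := by
  induction h <;> rintro p heq hb <;> cases heq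
  case rp1 => cases hb
  case rp2 ih => cases hb with | pre _ h => exact ih _ rfl h
  case rp3 ih₁ _ => cases hb with | disj h _ => exact ih₁ _ rfl h
  case rp4 ih => cases hb with | ext h _ => exact ih _ rfl h
  case rp5 ih => cases hb with | ext _ h => exact ih _ rfl h
  case rp6 ih => cases hb with | par _ h _ => exact ih _ rfl h
  case rp7 ih => cases hb with | par _ _ h => exact ih _ rfl h
  case rp14 h _ ih => exact ih _ rfl (hb.unfold h.1)
  case rp15 ih =>
    -- The family of premises is nonempty, and it contains an inconsistency claim about an extended
    -- basic `q`.
    obtain ⟨q, hq⟩ := hM.exists_stablyReaches hb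
    exact ih q hq _ rfl (hM.extendedBasic_of_stablyReaches hq hb)
  -- Only rules concluding inconsistency of a conjunction remain.
  all_goals cases hb

end Tau

theorem isStableModel_model (Act Var : Type*) : IsStableModel (model Act Var) :=
  (existsUnique_isStableModel Act Var).choose_spec.1

end CLLR

theorem mainTheorem6 (Act Var : Type*) [Infinite Var] :
    CLLR.extendedBasicTerms Act Var ∩ CLLR.inconsistent Act Var = ∅ := by
  rw [Set.eq_empty_iff_forall_notMem]
  rintro t ⟨hb, h, hF⟩
  have hM := CLLR.isStableModel_model Act Var
  exact hM.not_incons (hM.mem_iff.1 hF) _ rfl hb
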